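/- **Definitions.** A generalized quadrangle $\mathrm{GQ}(s,t)$ ($s,t\ge 1$) is a non-empty incidence structure of points and lines in which two distinct points lie on at most one common line, every line has $s+1$ points, every point lies on $t+1$ lines, and for every point $P$ not on a line $L$ there is exactly one line through $P$ that intersects $L$. In its adjacency graph the vertices are the points, and two distinct points are adjacent when they lie on a common line. An identifying code of a graph is a set $C$ of vertices such that the sets $N[u]\cap C$ are non-empty and pairwise distinct for all vertices $u$, where $N[u]=N(u)\cup\{u\}$. For a prime power $q$, $H(3,q^2)$ is the incidence structure whose points are the points of $\mathrm{PG}(3,q^2)$ satisfying $X_0^{q+1}+X_1^{q+1}+X_2^{q+1}+X_3^{q+1}=0$ and whose lines are the lines of $\mathrm{PG}(3,q^2)$ all of whose points satisfy this equation. **Proposition.** There are absolute constants $a,b>0$ such that for every prime power $q$ the following holds. 1. $H(3,q^2)$ is a $\mathrm{GQ}(q^2,q)$. 2. There are three pairwise disjoint lines $L_0,L_1,L_2$ of $H(3,q^2)$, two distinct points $P_1,P_2\in L_0$, lines $M_1\ni P_1$ and $M_2\ni P_2$ of $H(3,q^2)$ different from $L_0$ and disjoint from $L_1$ and $L_2$,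 and a point $X\in L_1$ adjacent to neither $P_1$ nor $P_2$, such that the set $S=L_0\cup L_1\cup L_2\cup M_1\cup M_2$ is an identifying code of the adjacency graph of size $5q^2+3$, and the set $C$ obtained from $S$ by deleting $X$ and all neighbours of $X$ on $L_0\cup L_2\cup M_1\cup M_2$ is an identifying code of the adjacency graph of size $5q^2-2$. 3. If $n$ denotes the number of points of $H(3,q^2)$, then $a\,n^{2/5}\le 5q^2-2\le b\,n^{2/5}$; that is, $5q^2-2=\Theta(n^{2/5})$. -/

import Mathlib

open scoped LinearAlgebra.Projectivization

/-! ### Identifying codes of graphs -/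

namespace SimpleGraph

variable {V : Type*}

/-- The closed neighbourhood `N[u] = N(u) ∪ {u}`. -/
def closedNbhd (G : SimpleGraph V) (u : V) : Set V := insert u (G.neighborSet u)

/-- Every closed neighbourhood meets `S`. -/
def IsDominatingSet (G : SimpleGraph V) (S : Set V) : Prop :=
  ∀ u, (S ∩ G.closedNbhd u).Nonempty

/-- Any two distinct vertices `u`, `v` are separated by some `c ∈ S`, i.e. `c` lies in exactly
one of `N[u]` and `N[v]`. -/
def IsSeparatingSet (G : SimpleGraph V) (S : Set V) : Prop :=
  ∀ u v, u ≠ v → ∃ c ∈ S, c ∈ symmDiff (G.closedNbhd u) (G.closedNbhd v)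

/-- An identifying code is a dominating and separating set of vertices. -/
def IsIdentifyingCode (G : SimpleGraph V) (C : Set V) : Prop :=
  G.IsDominatingSet C ∧ G.IsSeparatingSet C

end SimpleGraph

/-! ### Generalized quadrangles -/

/-- The incidence structure with points `P`, lines `B` and incidence relation `inc` is a
generalized quadrangle `GQ(s, t)`. -/
structure IsGQ {P B : Type*} (inc : P → B → Prop) (s t : ℕ) : Prop where
  s_pos : 0 < s
  t_pos : 0 < t
  nonempty : Nonempty P
  /-- Two distinct points lie on at most one common line. -/
  line_unique : ∀ x y : P, x ≠ y → ∀ l m : B, inc x l → inc y l → inc x m → inc y m → l = m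
  /-- There are `s + 1` points on each line. -/
  points_on_line : ∀ l : B, {x | inc x l}.ncard = s + 1
  /-- There are `t + 1` lines through each point. -/
  lines_through_point : ∀ x : P, {l | inc x l}.ncard = t + 1
  /-- If `x` is not on `l`, exactly one line through `x` intersects `l`. -/
  projection : ∀ (x : P) (l : B), ¬ inc x l → ∃! m : B, inc x m ∧ ∃ y, inc y m ∧ inc y l

/-- The adjacency (collinearity) graph of an incidence structure: two distinct points are
adjacent when they lie on a common line. -/
def collinearityGraph {P B : Type*} (inc : P → B → Prop) : SimpleGraph P where
  Adj x y := x ≠ y ∧ ∃ l, inc x l ∧ inc y l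
  symm := ⟨fun _ _ ⟨h, l, hx, hy⟩ => ⟨h.symm, l, hy, hx⟩⟩
  loopless := ⟨fun _ h => h.1 rfl⟩

/-! ### The Hermitian surface `H(3, q²)`

`K` is meant to be a field with `q ^ 2` elements. -/

namespace Hermitian

/-- The points of `PG(3, K)` satisfying `X₀^(q+1) + X₁^(q+1) + X₂^(q+1) + X₃^(q+1) = 0`. The
equation is imposed on all representatives of the point. -/
def Point (q : ℕ) (K : Type*) [Field K] : Type _ :=
  {p : ℙ K (Fin 4 → K) // ∀ v ∈ p.submodule, ∑ i, v i ^ (q + 1) = 0}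

/-- The lines of `PG(3, K)` (two-dimensional subspaces of `K⁴`) all of whose points satisfy the
equation `X₀^(q+1) + X₁^(q+1) + X₂^(q+1) + X₃^(q+1) = 0`. -/
def Line (q : ℕ) (K : Type*) [Field K] : Type _ :=
  {l : Submodule K (Fin 4 → K) //
    Module.finrank K l = 2 ∧ ∀ v ∈ l, ∑ i, v i ^ (q + 1) = 0}

variable {q : ℕ} {K : Type*} [Field K]

/-- The point `x` lies on the line `l`. -/
def Inc (x : Point q K) (l : Line q K) : Prop := x.1.submodule ≤ l.1

/-- The set of points of `H(3, q²)` on the line `l`. -/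
def Line.points (l : Line q K) : Set (Point q K) := {x | Inc x l}

variable (q K) in
/-- The adjacency graph of `H(3, q²)`. -/
def graph : SimpleGraph (Point q K) := collinearityGraph (Inc (q := q) (K := K))

end Hermitian

/-!
The adjacency graph of a generalized quadrangle has no triangles except inside lines, so a point
off a line `L` is adjacent to exactly one point of `L`. Hence a set containing `L`, or all of `L`
but one point, knows this neighbour: if the only known points of `L` are not adjacent, the neighbour
is the missing point (`IsGQ.isCollinear_iff_of_forall_ne`). The deletions that lead from `S` to `C`
remove exactly one point from each of the five lines. Points of `L₀` are separated by their
neighbours on `L₁`, so it suffices to show that a point off `L₀` is determined by its neighbours on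
the five lines, a point of a line counting as its own neighbour there; that `S` is an identifying
code then follows from `C ⊆ S`.

The configuration (`IsFiveLines`) is built in a grid: `L₀, L₁, L₂` belong to one ruling, and
`P₁, P₂` are the points of `L₀` on two lines `n₁, n₂` of the other one; `Mᵢ` is a line through `Pᵢ`
other than `L₀` and `nᵢ`. Suppose `u ≠ v` off `L₀` have the same neighbours `a₀, a₁, a₂` on
`L₀, L₁, L₂` and the same neighbours on `M₁, M₂`. Some `Pᵢ` differs from `a₀`, so it is collinear
with `a₀` and with the neighbour on `Mᵢ`, two different common neighbours of `u` and `v`. Points of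
`H(3, q²)` are regular (`Hermitian.hasRegularPoints`): the common neighbours of `u` and `v` span a
plane of `K⁴`, already spanned by two of them. So `Pᵢ` is collinear with `a₁` and `a₂`, which
therefore lie on `nᵢ`; then `u` and `v`, collinear with `a₁` and `a₂`, lie on `nᵢ` too. The case of
collinear `u`, `v` is excluded by the absence of triangles (`IsFiveLines.eq_of_isCollinear`).

That `H(3, q²)` is a `GQ(q², q)` (`Hermitian.isGQ`) is linear algebra with the Hermitian form
`∑ xᵢ^q yᵢ`, resting on the fact that the orthogonal complement of a plane is a plane
(`Hermitian.finrank_perp`). To count the lines through a point `⟨p⟩`, the hyperplane orthogonal to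
`p` is written as `⟨p, e, f⟩` with `e, f` orthogonal and anisotropic; the lines correspond to the
solutions of a norm equation `z^(q+1) = c`, of which there are `q + 1` (`Hermitian.ncard_pow_eq`).
Finally a `GQ(q², q)` has `(q² + 1) (q³ + 1)` points (`IsGQ.card_points`).
-/

/-! ### Collinearity in generalized quadrangles -/

/-- Two (not necessarily distinct) points are collinear when some line contains both. -/
def IsCollinear {P B : Type*} (inc : P → B → Prop) (x y : P) : Prop :=
  ∃ l, inc x l ∧ inc y l

namespace IsGQ

variable {P B : Type*} {inc : P → B → Prop} {s t : ℕ}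

lemma _root_.IsCollinear.symm {x y : P} (h : IsCollinear inc x y) : IsCollinear inc y x :=
  let ⟨l, hx, hy⟩ := h
  ⟨l, hy, hx⟩

lemma isCollinear_refl (h : IsGQ inc s t) (x : P) : IsCollinear inc x x := by
  have hne : {l | inc x l}.Nonempty := by
    apply Set.nonempty_of_ncard_ne_zero
    rw [h.lines_through_point x]
    omega
  obtain ⟨l, hl⟩ := hne
  exact ⟨l, hl, hl⟩

lemma mem_closedNbhd (h : IsGQ inc s t) {x y : P} :
    y ∈ (collinearityGraph inc).closedNbhd x ↔ IsCollinear inc x y := by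
  constructor
  · rintro (rfl | hy)
    · exact h.isCollinear_refl y
    · exact hy.2
  · intro hxy
    by_cases e : y = x
    · exact Or.inl e
    · exact Or.inr ⟨fun e' => e e'.symm, hxy⟩

/-- A point collinear with two points of a line lies on that line: there are no triangles. -/
lemma inc_of_isCollinear (h : IsGQ inc s t) {x y z : P} {l : B} (hxy : x ≠ y)
    (hx : inc x l) (hy : inc y l) (hzx : IsCollinear inc z x) (hzy : IsCollinear inc z y) :
    inc z l := by
  by_contra hz
  obtain ⟨m, -, hm⟩ := h.projection z l hz
  obtain ⟨m₁, hz₁, hx₁⟩ := hzx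
  obtain ⟨m₂, hz₂, hy₂⟩ := hzy
  obtain rfl := hm m₁ ⟨hz₁, x, hx₁, hx⟩
  obtain rfl := hm m₂ ⟨hz₂, y, hy₂, hy⟩
  exact hz (h.line_unique x y hxy l m₂ hx hy hx₁ hy₂ ▸ hz₁)

lemma eq_of_isCollinear (h : IsGQ inc s t) {x y z : P} {l : B} (hz : ¬ inc z l)
    (hx : inc x l) (hy : inc y l) (hzx : IsCollinear inc z x) (hzy : IsCollinear inc z y) :
    x = y := by
  by_contra hxy
  exact hz (h.inc_of_isCollinear hxy hx hy hzx hzy)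

lemma exists_inc_isCollinear (h : IsGQ inc s t) (x : P) (l : B) :
    ∃ y, inc y l ∧ IsCollinear inc x y := by
  by_cases hx : inc x l
  · exact ⟨x, hx, l, hx, hx⟩
  · obtain ⟨m, ⟨hm, y, hy, hyl⟩, -⟩ := h.projection x l hx
    exact ⟨y, hyl, m, hm, hy⟩

lemma finite_points (h : IsGQ inc s t) (l : B) : {x | inc x l}.Finite :=
  Set.finite_of_ncard_pos (by rw [h.points_on_line l]; omega)

lemma finite_lines (h : IsGQ inc s t) (x : P) : {l | inc x l}.Finite :=
  Set.finite_of_ncard_pos (by rw [h.lines_through_point x]; omega)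

lemma card_points_toFinset (h : IsGQ inc s t) (l : B) :
    (h.finite_points l).toFinset.card = s + 1 := by
  rw [← Set.ncard_eq_toFinset_card _ (h.finite_points l), h.points_on_line l]

lemma card_lines_toFinset (h : IsGQ inc s t) (x : P) :
    (h.finite_lines x).toFinset.card = t + 1 := by
  rw [← Set.ncard_eq_toFinset_card _ (h.finite_lines x), h.lines_through_point x]

lemma exists_inc_ne_ne (h : IsGQ inc s t) (hs : 2 ≤ s) (l : B) (a b : P) :
    ∃ x, inc x l ∧ x ≠ a ∧ x ≠ b := by
  have hlt : ({a, b} : Set P).ncard < {x | inc x l}.ncard := by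
    rw [h.points_on_line l]
    have := Set.ncard_insert_le a {b}
    rw [Set.ncard_singleton] at this
    omega
  obtain ⟨x, hx, hx'⟩ := Set.exists_mem_notMem_of_ncard_lt_ncard hlt
  simp only [Set.mem_insert_iff, Set.mem_singleton_iff, not_or] at hx'
  exact ⟨x, hx, hx'⟩

lemma exists_line_ne_ne (h : IsGQ inc s t) (ht : 2 ≤ t) (x : P) (a b : B) :
    ∃ l, inc x l ∧ l ≠ a ∧ l ≠ b := by
  have hlt : ({a, b} : Set B).ncard < {l | inc x l}.ncard := by
    rw [h.lines_through_point x]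
    have := Set.ncard_insert_le a {b}
    rw [Set.ncard_singleton] at this
    omega
  obtain ⟨l, hl, hl'⟩ := Set.exists_mem_notMem_of_ncard_lt_ncard hlt
  simp only [Set.mem_insert_iff, Set.mem_singleton_iff, not_or] at hl'
  exact ⟨l, hl, hl'⟩

/-- Sorting the points off a line `l` by their unique neighbour `y` on `l`, and by the line
joining them to `y`, gives the number of points. -/
lemma card_points (h : IsGQ inc s t) : Nat.card P = (s + 1) * (s * t + 1) := by
  classical
  obtain ⟨x₀⟩ := h.nonempty
  obtain ⟨l, -, -⟩ := h.isCollinear_refl x₀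
  have hline (y : P) (hy : inc y l) :
      ∑ m ∈ (h.finite_lines y).toFinset.erase l,
        ((h.finite_points m).toFinset.erase y).card = t * s := by
    rw [Finset.sum_const_nat (m := s)]
    · rw [Finset.card_erase_of_mem (by simpa using hy), h.card_lines_toFinset y,
        Nat.add_sub_cancel]
    · intro m hm
      have hm : m ≠ l ∧ inc y m := by simpa using hm
      rw [Finset.card_erase_of_mem (by simpa using hm.2), h.card_points_toFinset m,
        Nat.add_sub_cancel]
  let T : Finset P := (h.finite_points l).toFinset.biUnion fun y =>
    ((h.finite_lines y).toFinset.erase l).biUnion fun m => (h.finite_points m).toFinset.erase y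
  have hmem (x : P) : x ∈ T ↔
      ∃ y, inc y l ∧ ∃ m, (m ≠ l ∧ inc y m) ∧ x ≠ y ∧ inc x m := by simp [T]
  have hT : T.card = (s + 1) * (t * s) := by
    rw [Finset.card_biUnion, Finset.sum_const_nat (m := t * s)]
    · rw [h.card_points_toFinset l]
    · intro y hy
      have hy : inc y l := by simpa using hy
      rw [Finset.card_biUnion, hline y hy]
      intro m hm m' hm' hne
      refine Finset.disjoint_left.2 fun x hx hx' => ?_
      simp only [Finset.mem_coe, Finset.mem_erase, Set.Finite.mem_toFinset,
        Set.mem_ofPred_eq] at hm hm' hx hx'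
      exact hne (h.line_unique x y hx.1 m m' hx.2 hm.2 hx'.2 hm'.2)
    · intro y hy y' hy' hne
      refine Finset.disjoint_left.2 fun x hx hx' => ?_
      simp only [Finset.mem_coe, Finset.mem_biUnion, Finset.mem_erase, Set.Finite.mem_toFinset,
        Set.mem_ofPred_eq] at hy hy' hx hx'
      obtain ⟨m, ⟨hml, hym⟩, hxy, hxm⟩ := hx
      obtain ⟨m', ⟨hml', hym'⟩, hxy', hxm'⟩ := hx'
      have hxl := h.inc_of_isCollinear hne hy hy' ⟨m, hxm, hym⟩ ⟨m', hxm', hym'⟩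
      exact hml (h.line_unique x y hxy m l hxm hym hxl hy)
  have hdisj : Disjoint T (h.finite_points l).toFinset := by
    rw [Finset.disjoint_left]
    intro x hx hxl
    obtain ⟨y, hy, m, ⟨hml, hym⟩, hxy, hxm⟩ := (hmem x).1 hx
    exact hml (h.line_unique x y hxy m l hxm hym (by simpa using hxl) hy)
  have huniv : ((T ∪ (h.finite_points l).toFinset : Finset P) : Set P) = Set.univ := by
    rw [Set.eq_univ_iff_forall]
    intro x
    rw [Finset.mem_coe, Finset.mem_union]
    by_cases hx : inc x l
    · exact Or.inr (by simpa using hx)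
    · obtain ⟨y, hy, m, hxm, hym⟩ := h.exists_inc_isCollinear x l
      refine Or.inl ((hmem x).2 ⟨y, hy, m, ⟨?_, hym⟩, ?_, hxm⟩)
      · rintro rfl
        exact hx hxm
      · rintro rfl
        exact hx hy
  rw [← Set.ncard_univ, ← huniv, Set.ncard_coe_finset, Finset.card_union_of_disjoint hdisj, hT,
    h.card_points_toFinset l]
  ring

end IsGQ

/-! ### The five lines -/

/-- The configuration underlying the codes: pairwise disjoint lines `L₀, L₁, L₂`, lines `M₁`, `M₂`
meeting `L₀` in distinct points `P₁`, `P₂` and missing `L₁`, `L₂`, and a point `X` of `L₁`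
collinear with neither `P₁` nor `P₂`. Through each of `P₁`, `P₂` there is a line meeting both `L₁`
and `L₂`, which is encoded by `transversal₁` and `transversal₂`: the neighbours of `Pᵢ` on `L₁`
and on `L₂` are collinear. -/
structure IsFiveLines {P B : Type*} (inc : P → B → Prop) (L₀ L₁ L₂ M₁ M₂ : B) (P₁ P₂ X : P) :
    Prop where
  disj₀₁ : ∀ x, inc x L₀ → ¬ inc x L₁
  disj₀₂ : ∀ x, inc x L₀ → ¬ inc x L₂
  disj₁₂ : ∀ x, inc x L₁ → ¬ inc x L₂
  ne : P₁ ≠ P₂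
  mem₁ : inc P₁ L₀
  mem₂ : inc P₂ L₀
  memM₁ : inc P₁ M₁
  memM₂ : inc P₂ M₂
  neM₁ : M₁ ≠ L₀
  neM₂ : M₂ ≠ L₀
  disjM₁₁ : ∀ x, inc x M₁ → ¬ inc x L₁
  disjM₁₂ : ∀ x, inc x M₁ → ¬ inc x L₂
  disjM₂₁ : ∀ x, inc x M₂ → ¬ inc x L₁
  disjM₂₂ : ∀ x, inc x M₂ → ¬ inc x L₂
  transversal₁ : ∀ a b, inc a L₁ → inc b L₂ → IsCollinear inc P₁ a → IsCollinear inc P₁ b →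
    IsCollinear inc a b
  transversal₂ : ∀ a b, inc a L₁ → inc b L₂ → IsCollinear inc P₂ a → IsCollinear inc P₂ b →
    IsCollinear inc a b
  memX : inc X L₁
  farX₁ : ¬ IsCollinear inc X P₁
  farX₂ : ¬ IsCollinear inc X P₂

namespace IsGQ

variable {P B : Type*} {inc : P → B → Prop} {s t : ℕ}

/-- Two lines meeting a third line in distinct points are disjoint. -/
lemma disjoint_of_meet (h : IsGQ inc s t) {a b : P} {l m n : B} (hab : a ≠ b)
    (ha : inc a n) (hb : inc b n) (hal : inc a l) (hbm : inc b m) (hln : l ≠ n) (hmn : m ≠ n)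
    (x : P) (hxl : inc x l) : ¬ inc x m := by
  intro hxm
  have hxn := h.inc_of_isCollinear hab ha hb ⟨l, hxl, hal⟩ ⟨m, hxm, hbm⟩
  by_cases hxa : x = a
  · subst hxa
    exact hmn (h.line_unique x b hab m n hxm hbm ha hb)
  · exact hln (h.line_unique x a hxa l n hxl hal hxn ha)

/-- The lines `L₀, L₁, L₂` are three lines of one ruling of a grid, whose other ruling contains
the lines `n₁ ∋ P₁` and `n₂ ∋ P₂`; the line `Mᵢ` is a third line through `Pᵢ`. -/
lemma exists_isFiveLines (h : IsGQ inc s t) (hs : 2 ≤ s) (ht : 2 ≤ t) :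
    ∃ L₀ L₁ L₂ M₁ M₂ P₁ P₂ X, IsFiveLines inc L₀ L₁ L₂ M₁ M₂ P₁ P₂ X := by
  obtain ⟨P₁⟩ := h.nonempty
  obtain ⟨L₀, h₁, -⟩ := h.isCollinear_refl P₁
  obtain ⟨P₂, h₂, hne, -⟩ := h.exists_inc_ne_ne hs L₀ P₁ P₁
  obtain ⟨n₁, hn₁, hn₁L, -⟩ := h.exists_line_ne_ne ht P₁ L₀ L₀
  obtain ⟨n₂, hn₂, hn₂L, -⟩ := h.exists_line_ne_ne ht P₂ L₀ L₀
  obtain ⟨M₁, hM₁, hM₁L, hM₁n⟩ := h.exists_line_ne_ne ht P₁ L₀ n₁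
  obtain ⟨M₂, hM₂, hM₂L, hM₂n⟩ := h.exists_line_ne_ne ht P₂ L₀ n₂
  have hdn := h.disjoint_of_meet hne.symm h₁ h₂ hn₁ hn₂ hn₁L hn₂L
  obtain ⟨Q₁, hQ₁, hQ₁P, -⟩ := h.exists_inc_ne_ne hs n₁ P₁ P₁
  obtain ⟨R₁, hR₁, hR₁P, hR₁Q⟩ := h.exists_inc_ne_ne hs n₁ P₁ Q₁
  obtain ⟨Q₂, hQ₂, L₁, hQ₁L, hQ₂L⟩ := h.exists_inc_isCollinear Q₁ n₂
  obtain ⟨R₂, hR₂, L₂, hR₁L, hR₂L⟩ := h.exists_inc_isCollinear R₁ n₂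
  have hL₀n : L₀ ≠ n₁ := hn₁L.symm
  have hL₁n : L₁ ≠ n₁ := by
    rintro rfl
    exact hdn _ hQ₂L hQ₂
  have hL₂n : L₂ ≠ n₁ := by
    rintro rfl
    exact hdn _ hR₂L hR₂
  have hd₀₁ := h.disjoint_of_meet hQ₁P.symm hn₁ hQ₁ h₁ hQ₁L hL₀n hL₁n
  have hd₀₂ := h.disjoint_of_meet hR₁P.symm hn₁ hR₁ h₁ hR₁L hL₀n hL₂n
  have hd₁₂ := h.disjoint_of_meet hR₁Q.symm hQ₁ hR₁ hQ₁L hR₁L hL₁n hL₂n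
  have hP₁₁ := hd₀₁ _ h₁
  have hP₁₂ := hd₀₂ _ h₁
  have hP₂₁ := hd₀₁ _ h₂
  have hP₂₂ := hd₀₂ _ h₂
  -- A line through `Pᵢ` other than `nᵢ` misses any line that `nᵢ` meets outside `Pᵢ`.
  have miss {p a : P} {n M L : B} (hpn : inc p n) (hpM : inc p M) (hMn : M ≠ n) (han : inc a n)
      (haL : inc a L) (hpL : ¬ inc p L) (x : P) (hxM : inc x M) : ¬ inc x L := by
    intro hxL
    obtain rfl := h.eq_of_isCollinear hpL haL hxL ⟨n, hpn, han⟩ ⟨M, hpM, hxM⟩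
    refine hMn (h.line_unique p a ?_ M n hpM hxM hpn han)
    rintro rfl
    exact hpL hxL
  obtain ⟨X, hX, hXQ₁, hXQ₂⟩ := h.exists_inc_ne_ne hs L₁ Q₁ Q₂
  exact ⟨L₀, L₁, L₂, M₁, M₂, P₁, P₂, X,
    { disj₀₁ := hd₀₁
      disj₀₂ := hd₀₂
      disj₁₂ := hd₁₂
      ne := hne.symm
      mem₁ := h₁
      mem₂ := h₂
      memM₁ := hM₁
      memM₂ := hM₂
      neM₁ := hM₁L
      neM₂ := hM₂L
      disjM₁₁ := miss hn₁ hM₁ hM₁n hQ₁ hQ₁L hP₁₁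
      disjM₁₂ := miss hn₁ hM₁ hM₁n hR₁ hR₁L hP₁₂
      disjM₂₁ := miss hn₂ hM₂ hM₂n hQ₂ hQ₂L hP₂₁
      disjM₂₂ := miss hn₂ hM₂ hM₂n hR₂ hR₂L hP₂₂
      transversal₁ := fun a b ha hb hPa hPb => by
        obtain rfl := h.eq_of_isCollinear hP₁₁ hQ₁L ha ⟨n₁, hn₁, hQ₁⟩ hPa
        obtain rfl := h.eq_of_isCollinear hP₁₂ hR₁L hb ⟨n₁, hn₁, hR₁⟩ hPb
        exact ⟨n₁, hQ₁, hR₁⟩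
      transversal₂ := fun a b ha hb hPa hPb => by
        obtain rfl := h.eq_of_isCollinear hP₂₁ hQ₂L ha ⟨n₂, hn₂, hQ₂⟩ hPa
        obtain rfl := h.eq_of_isCollinear hP₂₂ hR₂L hb ⟨n₂, hn₂, hR₂⟩ hPb
        exact ⟨n₂, hQ₂, hR₂⟩
      memX := hX
      farX₁ := fun hc => hXQ₁
        (h.eq_of_isCollinear hP₁₁ hX hQ₁L hc.symm ⟨n₁, hn₁, hQ₁⟩)
      farX₂ := fun hc => hXQ₂
        (h.eq_of_isCollinear hP₂₁ hX hQ₂L hc.symm ⟨n₂, hn₂, hQ₂⟩) }⟩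

end IsGQ

namespace IsFiveLines

variable {P B : Type*} {inc : P → B → Prop} {s t : ℕ} {L₀ L₁ L₂ M₁ M₂ : B} {P₁ P₂ X : P}

lemma disjM (F : IsFiveLines inc L₀ L₁ L₂ M₁ M₂ P₁ P₂ X) (h : IsGQ inc s t) (x : P)
    (hx : inc x M₁) : ¬ inc x M₂ :=
  h.disjoint_of_meet F.ne F.mem₁ F.mem₂ F.memM₁ F.memM₂ F.neM₁ F.neM₂ x hx

/-- The configuration is symmetric under exchanging the indices of `M₁, P₁` and `M₂, P₂`. -/
lemma swap (F : IsFiveLines inc L₀ L₁ L₂ M₁ M₂ P₁ P₂ X) :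
    IsFiveLines inc L₀ L₁ L₂ M₂ M₁ P₂ P₁ X where
  disj₀₁ := F.disj₀₁
  disj₀₂ := F.disj₀₂
  disj₁₂ := F.disj₁₂
  ne := F.ne.symm
  mem₁ := F.mem₂
  mem₂ := F.mem₁
  memM₁ := F.memM₂
  memM₂ := F.memM₁
  neM₁ := F.neM₂
  neM₂ := F.neM₁
  disjM₁₁ := F.disjM₂₁
  disjM₁₂ := F.disjM₂₂
  disjM₂₁ := F.disjM₁₁
  disjM₂₂ := F.disjM₁₂
  transversal₁ := F.transversal₂
  transversal₂ := F.transversal₁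
  memX := F.memX
  farX₁ := F.farX₂
  farX₂ := F.farX₁

/-- The five-line code with the point `X` and its neighbours on the lines other than `L₁`
deleted. -/
def smallCode (inc : P → B → Prop) (L₀ L₁ L₂ M₁ M₂ : B) (X : P) : Set P :=
  ({x | inc x L₀} ∪ {x | inc x L₁} ∪ {x | inc x L₂} ∪ {x | inc x M₁} ∪ {x | inc x M₂}) \
    ({X} ∪ ((collinearityGraph inc).neighborSet X ∩
      ({x | inc x L₀} ∪ {x | inc x L₂} ∪ {x | inc x M₁} ∪ {x | inc x M₂})))

end IsFiveLines

/-- All points are regular: if `u` and `v` are not collinear, a point collinear with two common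
neighbours of `u` and `v` is collinear with all of them. -/
def HasRegularPoints {P B : Type*} (inc : P → B → Prop) : Prop :=
  ∀ u v a b c p, ¬ IsCollinear inc u v → a ≠ b →
    IsCollinear inc u a → IsCollinear inc v a → IsCollinear inc u b → IsCollinear inc v b →
    IsCollinear inc u c → IsCollinear inc v c →
    IsCollinear inc p a → IsCollinear inc p b → IsCollinear inc p c

namespace IsFiveLines

variable {P B : Type*} {inc : P → B → Prop} {s t : ℕ} {L₀ L₁ L₂ M₁ M₂ : B} {P₁ P₂ X : P}

/-- A point off `L₀` whose neighbour on `L₀` is not `P₁` is determined by its neighbours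
on the four lines `L₀, L₁, L₂, M₁`. -/
lemma eq_of_isCollinear (F : IsFiveLines inc L₀ L₁ L₂ M₁ M₂ P₁ P₂ X) (h : IsGQ inc s t)
    (hreg : HasRegularPoints inc) {u v a₀ a₁ a₂ c : P} (hu : ¬ inc u L₀) (ha : a₀ ≠ P₁)
    (ha₀ : inc a₀ L₀) (ha₁ : inc a₁ L₁) (ha₂ : inc a₂ L₂) (hc : inc c M₁)
    (hu₀ : IsCollinear inc u a₀) (hv₀ : IsCollinear inc v a₀)
    (hu₁ : IsCollinear inc u a₁) (hv₁ : IsCollinear inc v a₁)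
    (hu₂ : IsCollinear inc u a₂) (hv₂ : IsCollinear inc v a₂)
    (huc : IsCollinear inc u c) (hvc : IsCollinear inc v c) : u = v := by
  by_contra huv
  have hac : a₀ ≠ c := by
    rintro rfl
    exact F.neM₁ (h.line_unique a₀ P₁ ha M₁ L₀ hc F.memM₁ ha₀ F.mem₁)
  by_cases hcoll : IsCollinear inc u v
  · -- The line `uv` contains `a₀` and `c`, and forms a triangle with `L₀` and `M₁`.
    obtain ⟨m, hum, hvm⟩ := hcoll
    have ham := h.inc_of_isCollinear huv hum hvm hu₀.symm hv₀.symm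
    have hcm := h.inc_of_isCollinear huv hum hvm huc.symm hvc.symm
    have hPm := h.inc_of_isCollinear hac ham hcm ⟨L₀, F.mem₁, ha₀⟩ ⟨M₁, F.memM₁, hc⟩
    obtain rfl := h.line_unique a₀ P₁ ha m L₀ ham hPm ha₀ F.mem₁
    exact hu hum
  · -- `P₁` is collinear with `a₀` and `c`, hence by regularity also with `a₁` and `a₂`.
    have h₁ := hreg u v a₀ c a₁ P₁ hcoll hac hu₀ hv₀ huc hvc hu₁ hv₁
      ⟨L₀, F.mem₁, ha₀⟩ ⟨M₁, F.memM₁, hc⟩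
    have h₂ := hreg u v a₀ c a₂ P₁ hcoll hac hu₀ hv₀ huc hvc hu₂ hv₂
      ⟨L₀, F.mem₁, ha₀⟩ ⟨M₁, F.memM₁, hc⟩
    obtain ⟨n, hn₁, hn₂⟩ := F.transversal₁ a₁ a₂ ha₁ ha₂ h₁ h₂
    have h₁₂ : a₁ ≠ a₂ := by
      rintro rfl
      exact F.disj₁₂ _ ha₁ ha₂
    exact hcoll ⟨n, h.inc_of_isCollinear h₁₂ hn₁ hn₂ hu₁ hu₂,
      h.inc_of_isCollinear h₁₂ hn₁ hn₂ hv₁ hv₂⟩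

/-- Deleting one point `d` of a line `l` from a set containing `l` loses no information: the
collinearities of a point with `l \ {d}` determine those with `l`. -/
lemma _root_.IsGQ.isCollinear_iff_of_forall_ne (h : IsGQ inc s t) (hs : 2 ≤ s) {u v d : P} {l : B}
    (hd : inc d l)
    (huv : ∀ c, inc c l → c ≠ d → (IsCollinear inc u c ↔ IsCollinear inc v c)) :
    (inc u l ↔ inc v l) ∧ ∀ c, inc c l → (IsCollinear inc u c ↔ IsCollinear inc v c) := by
  have key₁ {u v : P} (huv : ∀ c, inc c l → c ≠ d → (IsCollinear inc u c ↔ IsCollinear inc v c))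
      (hu : inc u l) : inc v l := by
    obtain ⟨a, ha, had, -⟩ := h.exists_inc_ne_ne hs l d d
    obtain ⟨b, hb, hbd, hba⟩ := h.exists_inc_ne_ne hs l d a
    exact h.inc_of_isCollinear hba hb ha ((huv b hb hbd).1 ⟨l, hu, hb⟩)
      ((huv a ha had).1 ⟨l, hu, ha⟩)
  have huv' : ∀ c, inc c l → c ≠ d → (IsCollinear inc v c ↔ IsCollinear inc u c) :=
    fun c hc hcd => (huv c hc hcd).symm
  have key₂ {u v : P} (huv : ∀ c, inc c l → c ≠ d → (IsCollinear inc u c ↔ IsCollinear inc v c))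
      (huv' : ∀ c, inc c l → c ≠ d → (IsCollinear inc v c ↔ IsCollinear inc u c))
      (hud : IsCollinear inc u d) : IsCollinear inc v d := by
    by_cases hv : inc v l
    · exact ⟨l, hv, hd⟩
    · have hu : ¬ inc u l := fun hu => hv (key₁ huv hu)
      obtain ⟨c, hc, hvc⟩ := h.exists_inc_isCollinear v l
      by_cases hcd : c = d
      · exact hcd ▸ hvc
      · exact absurd (h.eq_of_isCollinear hu hc hd ((huv c hc hcd).2 hvc) hud) hcd
  refine ⟨⟨key₁ huv, key₁ huv'⟩, fun c hc => ?_⟩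
  by_cases hcd : c = d
  · subst hcd
    exact ⟨key₂ huv huv', key₂ huv' huv⟩
  · exact huv c hc hcd

lemma _root_.IsGQ.eq_of_isCollinear_disjoint (h : IsGQ inc s t) {u v : P} {l m : B}
    (hdisj : ∀ x, inc x l → ¬ inc x m) (hu : inc u l) (hv : inc v l)
    (huv : ∀ c, inc c m → (IsCollinear inc u c ↔ IsCollinear inc v c)) : u = v := by
  obtain ⟨c, hc, huc⟩ := h.exists_inc_isCollinear u m
  exact h.eq_of_isCollinear (fun hcl => hdisj c hcl hc) hu hv huc.symm
    ((huv c hc).1 huc).symm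

/-- The points of `smallCode` on each of the five lines are all but one: the deleted point is `X`
on `L₁` and the neighbour of `X` on the other lines. -/
lemma mem_smallCode (F : IsFiveLines inc L₀ L₁ L₂ M₁ M₂ P₁ P₂ X) (h : IsGQ inc s t) {x : P} :
    x ∈ smallCode inc L₀ L₁ L₂ M₁ M₂ X ↔
      (inc x L₁ ∧ x ≠ X) ∨
        ((inc x L₀ ∨ inc x L₂ ∨ inc x M₁ ∨ inc x M₂) ∧ ¬ IsCollinear inc X x) := by
  have hcol : IsCollinear inc X x ↔ x = X ∨ x ∈ (collinearityGraph inc).neighborSet X :=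
    h.mem_closedNbhd.symm
  simp only [smallCode, Set.mem_sdiff, Set.mem_union, Set.mem_inter_iff, Set.mem_ofPred_eq,
    Set.mem_singleton_iff, hcol]
  by_cases hx : inc x L₁
  · have h₀ : ¬ inc x L₀ := fun hx' => F.disj₀₁ x hx' hx
    have h₂ : ¬ inc x L₂ := F.disj₁₂ x hx
    have hM₁ : ¬ inc x M₁ := fun hx' => F.disjM₁₁ x hx' hx
    have hM₂ : ¬ inc x M₂ := fun hx' => F.disjM₂₁ x hx' hx
    simp [hx, h₀, h₂, hM₁, hM₂]
  · generalize (x ∈ (collinearityGraph inc).neighborSet X) = p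
    simp only [hx, or_false, false_and, false_or, not_or, not_and, or_assoc]
    constructor
    · rintro ⟨h₁, h₂, h₃⟩
      exact ⟨h₁, h₂, fun hp => by have := h₃ hp; tauto⟩
    · rintro ⟨h₁, h₂, h₃⟩
      exact ⟨h₁, h₂, fun hp => absurd hp h₃⟩

lemma isSeparatingSet_smallCode (F : IsFiveLines inc L₀ L₁ L₂ M₁ M₂ P₁ P₂ X) (h : IsGQ inc s t)
    (hs : 2 ≤ s) (hreg : HasRegularPoints inc) :
    (collinearityGraph inc).IsSeparatingSet (smallCode inc L₀ L₁ L₂ M₁ M₂ X) := by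
  intro u v huv
  by_contra hno
  have hC : ∀ c ∈ smallCode inc L₀ L₁ L₂ M₁ M₂ X,
      (IsCollinear inc u c ↔ IsCollinear inc v c) := by
    intro c hc
    by_contra hne
    refine hno ⟨c, hc, ?_⟩
    rw [Set.mem_symmDiff, h.mem_closedNbhd, h.mem_closedNbhd]
    tauto
  have other {l : B} (hXl : ¬ inc X l)
      (hl : ∀ x, inc x l → (inc x L₀ ∨ inc x L₂ ∨ inc x M₁ ∨ inc x M₂)) :
      (inc u l ↔ inc v l) ∧ ∀ c, inc c l → (IsCollinear inc u c ↔ IsCollinear inc v c) := by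
    obtain ⟨d, hd, hXd⟩ := h.exists_inc_isCollinear X l
    refine h.isCollinear_iff_of_forall_ne hs hd fun c hc hcd => hC c ?_
    exact (F.mem_smallCode h).2
      (Or.inr ⟨hl c hc, fun hXc => hcd (h.eq_of_isCollinear hXl hc hd hXc hXd)⟩)
  obtain ⟨m₀, c₀⟩ := other (l := L₀) (fun hx => F.disj₀₁ _ hx F.memX) (by tauto)
  obtain ⟨-, c₂⟩ := other (l := L₂) (F.disj₁₂ _ F.memX) (by tauto)
  obtain ⟨-, d₁⟩ := other (l := M₁) (fun hx => F.disjM₁₁ _ hx F.memX) (by tauto)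
  obtain ⟨-, d₂⟩ := other (l := M₂) (fun hx => F.disjM₂₁ _ hx F.memX) (by tauto)
  obtain ⟨-, c₁⟩ := h.isCollinear_iff_of_forall_ne hs (u := u) (v := v) F.memX
    fun c hc hcX => hC c ((F.mem_smallCode h).2 (Or.inl ⟨hc, hcX⟩))
  by_cases hu₀ : inc u L₀
  · exact huv (h.eq_of_isCollinear_disjoint F.disj₀₁ hu₀ (m₀.1 hu₀) c₁)
  obtain ⟨a₀, ha₀, hua₀⟩ := h.exists_inc_isCollinear u L₀
  obtain ⟨a₁, ha₁, hua₁⟩ := h.exists_inc_isCollinear u L₁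
  obtain ⟨a₂, ha₂, hua₂⟩ := h.exists_inc_isCollinear u L₂
  obtain ⟨b₁, hb₁, hub₁⟩ := h.exists_inc_isCollinear u M₁
  obtain ⟨b₂, hb₂, hub₂⟩ := h.exists_inc_isCollinear u M₂
  by_cases ha : a₀ = P₁
  · exact huv (F.swap.eq_of_isCollinear h hreg hu₀ (ha.trans_ne F.ne) ha₀ ha₁ ha₂ hb₂
      hua₀ ((c₀ _ ha₀).1 hua₀) hua₁ ((c₁ _ ha₁).1 hua₁) hua₂ ((c₂ _ ha₂).1 hua₂)
      hub₂ ((d₂ _ hb₂).1 hub₂))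
  · exact huv (F.eq_of_isCollinear h hreg hu₀ ha ha₀ ha₁ ha₂ hb₁
      hua₀ ((c₀ _ ha₀).1 hua₀) hua₁ ((c₁ _ ha₁).1 hua₁) hua₂ ((c₂ _ ha₂).1 hua₂)
      hub₁ ((d₁ _ hb₁).1 hub₁))


/-- The points whose neighbours on `L₁` are all deleted are those on lines through `X`; such a
point keeps its neighbour on `L₀` or on `M₁`, as the lines joining `X` to its neighbours there are
different. -/
lemma isDominatingSet_smallCode (F : IsFiveLines inc L₀ L₁ L₂ M₁ M₂ P₁ P₂ X) (h : IsGQ inc s t)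
    (hs : 2 ≤ s) :
    (collinearityGraph inc).IsDominatingSet (smallCode inc L₀ L₁ L₂ M₁ M₂ X) := by
  intro u
  suffices ∃ c, c ∈ smallCode inc L₀ L₁ L₂ M₁ M₂ X ∧ IsCollinear inc u c by
    obtain ⟨c, hc, huc⟩ := this
    exact ⟨c, hc, h.mem_closedNbhd.2 huc⟩
  simp only [F.mem_smallCode h]
  by_cases hu : inc u L₁
  · obtain ⟨c, hc, hcX, -⟩ := h.exists_inc_ne_ne hs L₁ X X
    exact ⟨c, Or.inl ⟨hc, hcX⟩, L₁, hu, hc⟩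
  obtain ⟨c, hc, huc⟩ := h.exists_inc_isCollinear u L₁
  by_cases hcX : c = X
  · subst hcX
    obtain ⟨a, ha, hua⟩ := h.exists_inc_isCollinear u L₀
    obtain ⟨b, hb, hub⟩ := h.exists_inc_isCollinear u M₁
    by_cases hXa : IsCollinear inc c a
    · by_cases hXb : IsCollinear inc c b
      · -- Otherwise `a` and `b` lie on the line joining `u` to `X`, and `X` is collinear with `P₁`.
        exfalso
        obtain ⟨m, hum, hcm⟩ := huc
        have huc : u ≠ c := by
          rintro rfl
          exact hu hc
        have ham := h.inc_of_isCollinear huc hum hcm hua.symm hXa.symm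
        have hbm := h.inc_of_isCollinear huc hum hcm hub.symm hXb.symm
        have hab : a ≠ b := by
          rintro rfl
          by_cases haP : a = P₁
          · exact F.farX₁ (haP ▸ hXa)
          · exact F.neM₁ (h.line_unique a P₁ haP M₁ L₀ hb F.memM₁ ha F.mem₁)
        exact F.farX₁ ⟨m, hcm, h.inc_of_isCollinear hab ham hbm ⟨L₀, F.mem₁, ha⟩
          ⟨M₁, F.memM₁, hb⟩⟩
      · exact ⟨b, Or.inr ⟨by tauto, hXb⟩, hub⟩
    · exact ⟨a, Or.inr ⟨by tauto, hXa⟩, hua⟩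
  · exact ⟨c, Or.inl ⟨hc, hcX⟩, huc⟩

lemma smallCode_isIdentifyingCode (F : IsFiveLines inc L₀ L₁ L₂ M₁ M₂ P₁ P₂ X)
    (h : IsGQ inc s t) (hs : 2 ≤ s) (hreg : HasRegularPoints inc) :
    (collinearityGraph inc).IsIdentifyingCode (smallCode inc L₀ L₁ L₂ M₁ M₂ X) :=
  ⟨F.isDominatingSet_smallCode h hs, F.isSeparatingSet_smallCode h hs hreg⟩

lemma _root_.SimpleGraph.IsIdentifyingCode.mono {V : Type*} {G : SimpleGraph V} {C S : Set V}
    (hC : G.IsIdentifyingCode C) (hCS : C ⊆ S) : G.IsIdentifyingCode S :=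
  ⟨fun u => (hC.1 u).mono (Set.inter_subset_inter_left _ hCS), fun u v huv =>
    let ⟨c, hc, hcuv⟩ := hC.2 u v huv
    ⟨c, hCS hc, hcuv⟩⟩

/-- The only common points of the five lines are `P₁`, on `L₀` and `M₁`, and `P₂`, on `L₀` and
`M₂`. -/
lemma ncard_union (F : IsFiveLines inc L₀ L₁ L₂ M₁ M₂ P₁ P₂ X) (h : IsGQ inc s t) :
    ({x | inc x L₀} ∪ {x | inc x L₁} ∪ {x | inc x L₂} ∪ {x | inc x M₁} ∪ {x | inc x M₂}).ncard
      = 5 * s + 3 := by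
  have f := h.finite_points
  have hM {p : P} {M : B} (hp : inc p L₀) (hpM : inc p M) (hne : M ≠ L₀) (x : P)
      (hx : inc x M) (hxp : x ≠ p) : ¬ inc x L₀ :=
    fun hx₀ => hne (h.line_unique x p hxp M L₀ hx hpM hx₀ hp)
  have hunion : ({x | inc x L₀} ∪ {x | inc x L₁} ∪ {x | inc x L₂} ∪ {x | inc x M₁} ∪
      {x | inc x M₂}) = {x | inc x L₀} ∪ {x | inc x L₁} ∪ {x | inc x L₂} ∪
        ({x | inc x M₁} \ {P₁}) ∪ ({x | inc x M₂} \ {P₂}) := by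
    have h₁ := F.mem₁
    have h₂ := F.mem₂
    ext x
    by_cases hx₁ : x = P₁
    · subst hx₁; simp [h₁]
    · by_cases hx₂ : x = P₂
      · subst hx₂; simp [h₂]
      · simp [hx₁, hx₂]
  rw [hunion, Set.ncard_union_eq _ ((((f _).union (f _)).union (f _)).union ((f _).sdiff))
      (f _).sdiff, Set.ncard_union_eq _ (((f _).union (f _)).union (f _)) (f _).sdiff,
    Set.ncard_union_eq _ ((f _).union (f _)) (f _), Set.ncard_union_eq _ (f _) (f _),
    Set.ncard_sdiff_singleton_of_mem (show P₁ ∈ {x | inc x M₁} from F.memM₁),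
    Set.ncard_sdiff_singleton_of_mem (show P₂ ∈ {x | inc x M₂} from F.memM₂)]
  · simp only [h.points_on_line]
    omega
  · exact Set.disjoint_left.2 F.disj₀₁
  · rw [Set.disjoint_left]
    rintro x (hx | hx)
    exacts [F.disj₀₂ x hx, F.disj₁₂ x hx]
  · rw [Set.disjoint_right]
    rintro x ⟨hx, hxP⟩ ((hx' | hx') | hx')
    exacts [hM F.mem₁ F.memM₁ F.neM₁ x hx hxP hx', F.disjM₁₁ x hx hx', F.disjM₁₂ x hx hx']
  · rw [Set.disjoint_right]
    rintro x ⟨hx, hxP⟩ (((hx' | hx') | hx') | ⟨hx', -⟩)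
    exacts [hM F.mem₂ F.memM₂ F.neM₂ x hx hxP hx', F.disjM₂₁ x hx hx', F.disjM₂₂ x hx hx',
      F.disjM h x hx' hx]

/-- The deleted points are `X` and one point on each of the other four lines. -/
lemma ncard_smallCode (F : IsFiveLines inc L₀ L₁ L₂ M₁ M₂ P₁ P₂ X) (h : IsGQ inc s t) :
    (smallCode inc L₀ L₁ L₂ M₁ M₂ X).ncard = 5 * s - 2 := by
  obtain ⟨a, ha, hXa⟩ := h.exists_inc_isCollinear X L₀
  obtain ⟨b, hb, hXb⟩ := h.exists_inc_isCollinear X L₂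
  obtain ⟨c, hc, hXc⟩ := h.exists_inc_isCollinear X M₁
  obtain ⟨d, hd, hXd⟩ := h.exists_inc_isCollinear X M₂
  have hX₀ : ¬ inc X L₀ := fun hx => F.disj₀₁ X hx F.memX
  have hX₂ : ¬ inc X L₂ := F.disj₁₂ X F.memX
  have hX₃ : ¬ inc X M₁ := fun hx => F.disjM₁₁ X hx F.memX
  have hX₄ : ¬ inc X M₂ := fun hx => F.disjM₂₁ X hx F.memX
  have hdel : ({X} ∪ ((collinearityGraph inc).neighborSet X ∩
      ({x | inc x L₀} ∪ {x | inc x L₂} ∪ {x | inc x M₁} ∪ {x | inc x M₂}))) =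
      ({X, a, b, c, d} : Set P) := by
    ext x
    have key {l : B} {y : P} (hXl : ¬ inc X l) (hy : inc y l) (hXy : IsCollinear inc X y) :
        ((X ≠ x ∧ IsCollinear inc X x) ∧ inc x l) ↔ x = y := by
      constructor
      · rintro ⟨⟨-, hXx⟩, hx⟩
        exact h.eq_of_isCollinear hXl hx hy hXx hXy
      · rintro rfl
        refine ⟨⟨?_, hXy⟩, hy⟩
        rintro rfl
        exact hXl hy
    have hadj : x ∈ (collinearityGraph inc).neighborSet X ↔ X ≠ x ∧ IsCollinear inc X x :=
      Iff.rfl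
    simp only [Set.mem_union, Set.mem_inter_iff, Set.mem_ofPred_eq, Set.mem_singleton_iff, hadj,
      Set.mem_insert_iff, and_or_left, key hX₀ ha hXa, key hX₂ hb hXb, key hX₃ hc hXc,
      key hX₄ hd hXd, or_assoc]
  -- On `L₀` a point of `M₁` or `M₂` is `P₁` or `P₂`, which is not collinear with `X`.
  have far {p y : P} {M : B} (hp : inc p L₀) (hpM : inc p M) (hne : M ≠ L₀)
      (hXp : ¬ IsCollinear inc X p) (hy : inc y M) (hXy : IsCollinear inc X y) : ¬ inc y L₀ := by
    intro hy₀
    refine hne (h.line_unique y p ?_ M L₀ hy hpM hy₀ hp)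
    rintro rfl
    exact hXp hXy
  have hcL := far F.mem₁ F.memM₁ F.neM₁ F.farX₁ hc hXc
  have hdL := far F.mem₂ F.memM₂ F.neM₂ F.farX₂ hd hXd
  have hcard : ({X, a, b, c, d} : Set P).ncard = 5 := by
    have e {l : B} {x y : P} (hx : inc x l) (hy : ¬ inc y l) : x ≠ y := by
      rintro rfl
      exact hy hx
    have n₁ : X ≠ a := (e ha hX₀).symm
    have n₂ : X ≠ b := (e hb hX₂).symm
    have n₃ : X ≠ c := (e hc hX₃).symm
    have n₄ : X ≠ d := (e hd hX₄).symm
    have n₅ : a ≠ b := e ha (fun hx => F.disj₀₂ b hx hb)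
    have n₆ : a ≠ c := e ha hcL
    have n₇ : a ≠ d := e ha hdL
    have n₈ : b ≠ c := e hb (F.disjM₁₂ c hc)
    have n₉ : b ≠ d := e hb (F.disjM₂₂ d hd)
    have n₁₀ : c ≠ d := e hc (fun hx => F.disjM h d hx hd)
    rw [Set.ncard_insert_of_notMem (by simp [n₁, n₂, n₃, n₄]),
      Set.ncard_insert_of_notMem (by simp [n₅, n₆, n₇]),
      Set.ncard_insert_of_notMem (by simp [n₈, n₉]), Set.ncard_pair n₁₀]
  have hX := F.memX
  rw [smallCode, hdel, Set.ncard_sdiff, hcard, F.ncard_union h]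
  · omega
  · rintro x (rfl | rfl | rfl | rfl | rfl) <;> simp [*]

end IsFiveLines

/-! ### The Hermitian form on `K⁴` -/

namespace Hermitian

variable {q : ℕ} {K : Type*} [Field K]

lemma finite_of_card {K : Type*} (hq : IsPrimePow q) (hK : Nat.card K = q ^ 2) : Finite K :=
  Nat.finite_of_card_ne_zero (by rw [hK]; exact pow_ne_zero 2 hq.pos.ne')

/-- The Hermitian form `∑ xᵢ^q yᵢ`, as a linear form in its second argument `y`. -/
def form (q : ℕ) (x : Fin 4 → K) : (Fin 4 → K) →ₗ[K] K :=
  ∑ i, (x i ^ q) • LinearMap.proj i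

lemma form_apply (x y : Fin 4 → K) : form q x y = ∑ i, x i ^ q * y i := by
  simp [form, LinearMap.sum_apply]

lemma form_self (x : Fin 4 → K) : form q x x = ∑ i, x i ^ (q + 1) := by
  simp only [form_apply, pow_succ]

lemma add_pow_q (hq : IsPrimePow q) (hK : Nat.card K = q ^ 2) (a b : K) :
    (a + b) ^ q = a ^ q + b ^ q := by
  have := finite_of_card hq hK
  have := Fintype.ofFinite K
  obtain ⟨p, k, hp, hk, rfl⟩ := hq
  have hp' : p.Prime := hp.nat_prime
  have : Fact p.Prime := ⟨hp'⟩
  have hchar : CharP K p := by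
    obtain ⟨r, hr⟩ := CharP.exists K
    obtain ⟨n, hr', hn⟩ := FiniteField.card K r
    have hdvd : r ∣ (p ^ k) ^ 2 := by
      rw [← hK, Nat.card_eq_fintype_card, hn]
      exact dvd_pow_self r n.ne_zero
    have : r = p := (Nat.prime_dvd_prime_iff_eq hr' hp').1
      (hr'.dvd_of_dvd_pow (hr'.dvd_of_dvd_pow hdvd))
    exact this ▸ hr
  exact add_pow_expChar_pow a b p k

lemma pow_q_pow_q (hq : IsPrimePow q) (hK : Nat.card K = q ^ 2) (a : K) : (a ^ q) ^ q = a := by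
  have := finite_of_card hq hK
  rw [← pow_mul, ← sq, ← hK]
  have := Fintype.ofFinite K
  rw [Nat.card_eq_fintype_card]
  exact FiniteField.pow_card a

lemma sum_pow_q (hq : IsPrimePow q) (hK : Nat.card K = q ^ 2) {ι : Type*} (s : Finset ι)
    (f : ι → K) : (∑ i ∈ s, f i) ^ q = ∑ i ∈ s, f i ^ q := by
  classical
  induction s using Finset.induction_on with
  | empty => simp [hq.pos.ne']
  | insert i s hi ih => rw [Finset.sum_insert hi, Finset.sum_insert hi, add_pow_q hq hK, ih]

lemma neg_pow_q (hq : IsPrimePow q) (hK : Nat.card K = q ^ 2) (a : K) : (-a) ^ q = -a ^ q := by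
  have h := add_pow_q hq hK a (-a)
  rw [add_neg_cancel, zero_pow hq.pos.ne'] at h
  exact (neg_eq_of_add_eq_zero_right h.symm).symm

lemma form_add_left (hq : IsPrimePow q) (hK : Nat.card K = q ^ 2) (x y z : Fin 4 → K) :
    form q (x + y) z = form q x z + form q y z := by
  simp only [form_apply, Pi.add_apply, add_pow_q hq hK, add_mul, Finset.sum_add_distrib]

lemma form_smul_left (c : K) (x z : Fin 4 → K) : form q (c • x) z = c ^ q * form q x z := by
  simp only [form_apply, Pi.smul_apply, smul_eq_mul, mul_pow, Finset.mul_sum, mul_assoc]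

lemma form_swap (hq : IsPrimePow q) (hK : Nat.card K = q ^ 2) (x y : Fin 4 → K) :
    form q x y ^ q = form q y x := by
  simp only [form_apply, sum_pow_q hq hK, mul_pow, pow_q_pow_q hq hK]
  exact Finset.sum_congr rfl fun i _ => mul_comm _ _

lemma form_eq_zero_comm (hq : IsPrimePow q) (hK : Nat.card K = q ^ 2) {x y : Fin 4 → K}
    (h : form q x y = 0) : form q y x = 0 := by
  rw [← form_swap hq hK, h, zero_pow hq.pos.ne']

lemma form_ne_zero (hq : IsPrimePow q) {x : Fin 4 → K} (hx : x ≠ 0) : form q x ≠ 0 := by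
  intro h
  apply hx
  ext i
  have := LinearMap.congr_fun h (Pi.single i 1)
  simpa [form_apply, Pi.single_apply, hq.pos.ne'] using this

/-- Not all elements of `K` have trace zero over the subfield with `q` elements. -/
lemma exists_add_pow_q_ne_zero (hq : IsPrimePow q) (hK : Nat.card K = q ^ 2) :
    ∃ c : K, c + c ^ q ≠ 0 := by
  have := finite_of_card hq hK
  have := Fintype.ofFinite K
  by_contra! h
  -- The polynomial `T + T^q` has at most `q < q²` roots.
  have hdeg : (Polynomial.X + Polynomial.X ^ q : Polynomial K).natDegree = q := by
    rw [Polynomial.natDegree_add_eq_right_of_natDegree_lt, Polynomial.natDegree_X_pow]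
    rw [Polynomial.natDegree_X_pow, Polynomial.natDegree_X]
    exact hq.one_lt
  have h0 : (Polynomial.X + Polynomial.X ^ q : Polynomial K) ≠ 0 := by
    intro h0
    rw [h0, Polynomial.natDegree_zero] at hdeg
    exact hq.pos.ne hdeg
  have hle := Polynomial.card_le_degree_of_subset_roots
    (p := (Polynomial.X + Polynomial.X ^ q : Polynomial K)) (Z := Finset.univ) (by
      intro c _
      rw [Polynomial.mem_roots h0]
      simpa using h c)
  rw [hdeg, Finset.card_univ, ← Nat.card_eq_fintype_card, hK] at hle
  nlinarith [hq.one_lt]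

/-- Polarization: on a subspace all of whose vectors are isotropic the form vanishes. -/
lemma form_eq_zero_of_isotropic (hq : IsPrimePow q) (hK : Nat.card K = q ^ 2)
    {U : Submodule K (Fin 4 → K)} (hU : ∀ v ∈ U, ∑ i, v i ^ (q + 1) = 0) {v w : Fin 4 → K}
    (hv : v ∈ U) (hw : w ∈ U) : form q v w = 0 := by
  by_contra hne
  obtain ⟨c, hc⟩ := exists_add_pow_q_ne_zero hq hK
  apply hc
  have hvw := hU _ (U.add_mem hv (U.smul_mem (c / form q v w) hw))
  have hv' := hU v hv
  have hw' := hU w hw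
  rw [← form_self] at hvw hv' hw'
  have e : c / form q v w * form q v w = c := div_mul_cancel₀ c hne
  rw [form_add_left hq hK, map_add, map_add, hv', map_smul, map_smul, form_smul_left,
    form_smul_left, hw', ← form_swap hq hK v w, ← mul_pow, smul_eq_mul, e] at hvw
  simpa using hvw

/-- The vectors orthogonal to both `x` and `y`. -/
def perp (q : ℕ) (x y : Fin 4 → K) : Submodule K (Fin 4 → K) :=
  LinearMap.ker (form q x) ⊓ LinearMap.ker (form q y)

lemma mem_perp {x y z : Fin 4 → K} : z ∈ perp q x y ↔ form q x z = 0 ∧ form q y z = 0 := Iff.rfl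

lemma finrank_ker_form (hq : IsPrimePow q) {x : Fin 4 → K} (hx : x ≠ 0) :
    Module.finrank K (LinearMap.ker (form q x)) = 3 := by
  have := Module.Dual.finrank_ker_add_one_of_ne_zero (form_ne_zero hq hx)
  rw [Module.finrank_fin_fun] at this
  omega

lemma finrank_perp (hq : IsPrimePow q) (hK : Nat.card K = q ^ 2) {x y : Fin 4 → K}
    (h : LinearIndependent K ![x, y]) : Module.finrank K (perp q x y) = 2 := by
  have hx : x ≠ 0 := h.ne_zero 0
  have hy : y ≠ 0 := h.ne_zero 1
  apply le_antisymm
  · have hlt : perp q x y < LinearMap.ker (form q x) := by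
      refine lt_of_le_of_ne inf_le_left fun heq => ?_
      have hle : LinearMap.ker (form q x) ≤ LinearMap.ker (form q y) := inf_eq_left.1 heq
      have hmem := mem_span_of_iInf_ker_le_ker (ι := Unit) (L := fun _ => form q x)
        (K := form q y) (by simpa using hle)
      rw [Set.range_const, Submodule.mem_span_singleton] at hmem
      obtain ⟨c, hc⟩ := hmem
      rw [LinearIndependent.pair_iff' hx] at h
      refine h (c ^ q) ?_
      by_contra hne
      refine form_ne_zero hq (sub_ne_zero.2 hne) ?_
      rw [sub_eq_add_neg, ← neg_one_smul K y]
      refine LinearMap.ext fun z => ?_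
      rw [form_add_left hq hK, form_smul_left, form_smul_left, pow_q_pow_q hq hK,
        neg_pow_q hq hK, ← hc]
      simp
    have := Submodule.finrank_lt_finrank_of_lt hlt
    rw [finrank_ker_form hq hx] at this
    omega
  · have h₁ := Submodule.finrank_sup_add_finrank_inf_eq (LinearMap.ker (form q x))
      (LinearMap.ker (form q y))
    have h₂ := Submodule.finrank_le (LinearMap.ker (form q x) ⊔ LinearMap.ker (form q y))
    rw [finrank_ker_form hq hx, finrank_ker_form hq hy] at h₁
    rw [Module.finrank_fin_fun] at h₂
    change 2 ≤ Module.finrank K ↥(LinearMap.ker (form q x) ⊓ LinearMap.ker (form q y))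
    omega

lemma finrank_span_pair {x y : Fin 4 → K} (h : LinearIndependent K ![x, y]) :
    Module.finrank K (Submodule.span K {x, y}) = 2 := by
  have := finrank_span_eq_card h
  rwa [Matrix.range_cons_cons_empty, Fintype.card_fin] at this

lemma span_pair_eq_of_finrank {U : Submodule K (Fin 4 → K)} (hU : Module.finrank K U = 2)
    {x y : Fin 4 → K} (h : LinearIndependent K ![x, y]) (hx : x ∈ U) (hy : y ∈ U) :
    Submodule.span K {x, y} = U := by
  refine Submodule.eq_of_le_of_finrank_eq ?_ (by rw [finrank_span_pair h, hU])
  rw [Submodule.span_le]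
  rintro z (rfl | rfl)
  exacts [hx, hy]

lemma span_pair_eq_perp (hq : IsPrimePow q) (hK : Nat.card K = q ^ 2) {u v x y : Fin 4 → K}
    (huv : LinearIndependent K ![u, v]) (h : LinearIndependent K ![x, y])
    (hx : x ∈ perp q u v) (hy : y ∈ perp q u v) : Submodule.span K {x, y} = perp q u v :=
  span_pair_eq_of_finrank (finrank_perp hq hK huv) h hx hy

lemma exists_basis_pair {U : Submodule K (Fin 4 → K)} (hU : Module.finrank K U = 2) :
    ∃ x ∈ U, ∃ y ∈ U, LinearIndependent K ![x, y] := by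
  have hne : U ≠ ⊥ := by
    rintro rfl
    simp at hU
  obtain ⟨x, hx, hx0⟩ := U.ne_bot_iff.1 hne
  have hlt : ¬ U ≤ Submodule.span K {x} := by
    intro hle
    have h₁ := Submodule.finrank_mono hle
    rw [hU, finrank_span_singleton hx0] at h₁
    omega
  obtain ⟨y, hy, hyx⟩ := SetLike.not_le_iff_exists.1 hlt
  refine ⟨x, hx, y, hy, (LinearIndependent.pair_iff' hx0).2 fun c hc => hyx ?_⟩
  exact hc ▸ Submodule.smul_mem _ c (Submodule.mem_span_singleton_self x)

/-- A totally isotropic plane is its own orthogonal complement. -/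
lemma mem_of_form_eq_zero (hq : IsPrimePow q) (hK : Nat.card K = q ^ 2)
    {U : Submodule K (Fin 4 → K)} (hU : Module.finrank K U = 2)
    (hiso : ∀ v ∈ U, ∑ i, v i ^ (q + 1) = 0) {z : Fin 4 → K} (hz : ∀ v ∈ U, form q v z = 0) :
    z ∈ U := by
  obtain ⟨x, hx, y, hy, hxy⟩ := exists_basis_pair hU
  have := span_pair_eq_perp hq hK hxy hxy
    ⟨form_eq_zero_of_isotropic hq hK hiso hx hx, form_eq_zero_of_isotropic hq hK hiso hy hx⟩
    ⟨form_eq_zero_of_isotropic hq hK hiso hx hy, form_eq_zero_of_isotropic hq hK hiso hy hy⟩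
  rw [← span_pair_eq_of_finrank hU hxy hx hy, this]
  exact ⟨hz x hx, hz y hy⟩

/-- The span of two orthogonal isotropic vectors is totally isotropic. -/
lemma isotropic_span_pair (hq : IsPrimePow q) (hK : Nat.card K = q ^ 2) {x y : Fin 4 → K}
    (hx : form q x x = 0) (hxy : form q x y = 0) (hy : form q y y = 0) :
    ∀ v ∈ Submodule.span K {x, y}, ∑ i, v i ^ (q + 1) = 0 := by
  intro v hv
  obtain ⟨a, b, rfl⟩ := Submodule.mem_span_pair.1 hv
  rw [← form_self, form_add_left hq hK]
  simp [form_smul_left, hx, hxy, hy, form_eq_zero_comm hq hK hxy]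

/-- A norm equation `z^(q+1) = c` with `c` a nonzero element of the subfield with `q` elements has
`q + 1` solutions, as the group of units of `K` is cyclic of order `(q + 1) (q - 1)`. -/
lemma ncard_pow_eq (hq : IsPrimePow q) (hK : Nat.card K = q ^ 2) {c : K} (hc : c ≠ 0)
    (hcq : c ^ q = c) : {z : K | z ^ (q + 1) = c}.ncard = q + 1 := by
  classical
  have := finite_of_card hq hK
  have := Fintype.ofFinite K
  have hq1 : 1 < q := hq.one_lt
  have hcard : Nat.card Kˣ = (q + 1) * (q - 1) := by
    rw [Nat.card_units, hK, ← Nat.sq_sub_sq, one_pow]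
  obtain ⟨g, hg⟩ := IsCyclic.exists_generator (α := Kˣ)
  have hord : orderOf g = (q + 1) * (q - 1) := by
    rw [orderOf_eq_card_of_forall_mem_zpowers hg, hcard]
  have hprim : IsPrimitiveRoot ((g ^ (q - 1) : Kˣ) : K) (q + 1) := by
    rw [IsPrimitiveRoot.coe_units_iff]
    refine (hord ▸ IsPrimitiveRoot.orderOf g).pow ?_ (by ring)
    exact Nat.mul_pos (by omega) (by omega)
  have hex : ∃ z : K, z ^ (q + 1) = c := by
    obtain ⟨k, hk⟩ := (mem_powers_iff_mem_zpowers).2 (hg (Units.mk0 c hc))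
    have hk1 : g ^ (k * (q - 1)) = 1 := by
      rw [pow_mul]
      simp only at hk
      rw [hk]
      ext
      have : c ^ (q - 1) * c = 1 * c := by
        rw [← pow_succ, Nat.sub_add_cancel hq1.le, hcq, one_mul]
      simpa using mul_right_cancel₀ hc this
    have hdvd := orderOf_dvd_of_pow_eq_one hk1
    rw [hord] at hdvd
    obtain ⟨m, rfl⟩ := Nat.dvd_of_mul_dvd_mul_right (by omega) hdvd
    refine ⟨((g ^ m : Kˣ) : K), ?_⟩
    have := congrArg (fun u : Kˣ => (u : K)) hk
    simp only [Units.val_mk0] at this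
    rw [← this, ← Units.val_pow_eq_pow_val, ← pow_mul, mul_comm]
  have hset : {z : K | z ^ (q + 1) = c} =
      ((Polynomial.nthRoots (q + 1) c).toFinset : Set K) := by
    ext z
    simp [Polynomial.mem_nthRoots (Nat.succ_pos q)]
  rw [hset, Set.ncard_coe_finset, Multiset.toFinset_card_of_nodup (hprim.nthRoots_nodup hc),
    hprim.card_nthRoots, if_pos hex]

end Hermitian

/-! ### The generalized quadrangle -/

namespace Hermitian

variable {q : ℕ} {K : Type*} [Field K]

lemma inc_iff {x : Point q K} {l : Line q K} : Inc x l ↔ x.1.rep ∈ l.1 := by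
  rw [Inc, Projectivization.submodule_eq, Submodule.span_singleton_le_iff_mem]

lemma form_rep_self (x : Point q K) : form q x.1.rep x.1.rep = 0 := by
  rw [form_self]
  apply x.2
  rw [Projectivization.submodule_eq]
  exact Submodule.mem_span_singleton_self _

lemma linearIndependent_rep {x y : Point q K} (h : x ≠ y) :
    LinearIndependent K ![x.1.rep, y.1.rep] :=
  Projectivization.linearIndependent_pair_iff_ne.2 fun h' => h (Subtype.ext h')

/-- A nonzero isotropic vector represents a point of the Hermitian surface. -/
lemma exists_point {v : Fin 4 → K} (hv : v ≠ 0) (h : form q v v = 0) :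
    ∃ x : Point q K, (∀ l : Line q K, Inc x l ↔ v ∈ l.1) ∧ ∃ c : K, x.1.rep = c • v := by
  refine ⟨⟨Projectivization.mk K v hv, ?_⟩, fun l => ?_, ?_⟩
  · intro w hw
    rw [Projectivization.submodule_mk] at hw
    obtain ⟨c, rfl⟩ := Submodule.mem_span_singleton.1 hw
    rw [← form_self, form_smul_left, map_smul, h, smul_zero, mul_zero]
  · change (Projectivization.mk K v hv).submodule ≤ l.1 ↔ _
    rw [Projectivization.submodule_mk, Submodule.span_singleton_le_iff_mem]
  · obtain ⟨c, hc⟩ := Projectivization.exists_smul_eq_mk_rep K v hv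
    exact ⟨c, hc.symm⟩

lemma exists_line (hq : IsPrimePow q) (hK : Nat.card K = q ^ 2) {x y : Point q K} (hxy : x ≠ y)
    (h : form q x.1.rep y.1.rep = 0) : ∃ l : Line q K, Inc x l ∧ Inc y l := by
  refine ⟨⟨Submodule.span K {x.1.rep, y.1.rep}, finrank_span_pair (linearIndependent_rep hxy),
    isotropic_span_pair hq hK (form_rep_self x) h (form_rep_self y)⟩, ?_, ?_⟩
  · exact inc_iff.2 (Submodule.subset_span (Or.inl rfl))
  · exact inc_iff.2 (Submodule.subset_span (Or.inr rfl))

lemma form_eq_zero_of_isCollinear (hq : IsPrimePow q) (hK : Nat.card K = q ^ 2)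
    {x y : Point q K} (h : IsCollinear Inc x y) : form q x.1.rep y.1.rep = 0 := by
  obtain ⟨l, hx, hy⟩ := h
  exact form_eq_zero_of_isotropic hq hK l.2.2 (inc_iff.1 hx) (inc_iff.1 hy)

lemma span_rep_eq {x y : Point q K} (hxy : x ≠ y) {l : Line q K} (hx : Inc x l) (hy : Inc y l) :
    Submodule.span K {x.1.rep, y.1.rep} = l.1 :=
  span_pair_eq_of_finrank l.2.1 (linearIndependent_rep hxy) (inc_iff.1 hx) (inc_iff.1 hy)

lemma line_unique {x y : Point q K} (hxy : x ≠ y) {l m : Line q K} (hxl : Inc x l)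
    (hyl : Inc y l) (hxm : Inc x m) (hym : Inc y m) : l = m :=
  Subtype.ext ((span_rep_eq hxy hxl hyl).symm.trans (span_rep_eq hxy hxm hym))

lemma ncard_points (hq : IsPrimePow q) (hK : Nat.card K = q ^ 2) (l : Line q K) :
    {x | Inc x l}.ncard = q ^ 2 + 1 := by
  have := finite_of_card hq hK
  have hinj : Function.Injective l.1.subtype := l.1.subtype_injective
  have hsub (p : ℙ K l.1) : (Projectivization.map l.1.subtype hinj p).submodule ≤ l.1 := by
    induction p using Projectivization.ind with
    | h v hv =>
      rw [Projectivization.map_mk, Projectivization.submodule_mk,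
        Submodule.span_singleton_le_iff_mem]
      exact v.2
  let g (p : ℙ K l.1) : {x | Inc x l} :=
    ⟨⟨Projectivization.map l.1.subtype hinj p, fun v hv => l.2.2 v (hsub p hv)⟩, hsub p⟩
  have hg : Function.Bijective g := by
    constructor
    · intro p p' h
      apply Projectivization.map_injective l.1.subtype hinj
      exact congrArg (fun x : {x | Inc x l} => x.1.1) h
    · rintro ⟨x, hx⟩
      refine ⟨Projectivization.mk K ⟨x.1.rep, inc_iff.1 hx⟩ ?_, ?_⟩
      · intro h0
        exact x.1.rep_nonzero (congrArg Subtype.val h0)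
      · apply Subtype.ext
        apply Subtype.ext
        exact x.1.mk_rep
  rw [← Nat.card_coe_set_eq, ← Nat.card_eq_of_bijective g hg,
    Projectivization.card_of_finrank_two K l.1 l.2.1, hK]

/-- The hyperplane orthogonal to an isotropic vector is not totally isotropic. -/
lemma exists_orthogonal_anisotropic (hq : IsPrimePow q) (hK : Nat.card K = q ^ 2)
    {p : Fin 4 → K} (hp : p ≠ 0) (hpp : form q p p = 0) :
    ∃ e, form q p e = 0 ∧ form q e e ≠ 0 := by
  by_contra! h
  have hker : ∀ v ∈ LinearMap.ker (form q p), ∑ i, v i ^ (q + 1) = 0 := fun v hv => by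
    rw [← form_self]
    exact h v hv
  have hrank := finrank_ker_form hq hp
  have hlt : ¬ LinearMap.ker (form q p) ≤ Submodule.span K {p} := by
    intro hle
    have h₁ := Submodule.finrank_mono hle
    rw [hrank, finrank_span_singleton hp] at h₁
    omega
  obtain ⟨y, hy, hyp⟩ := SetLike.not_le_iff_exists.1 hlt
  have hLI : LinearIndependent K ![p, y] := (LinearIndependent.pair_iff' hp).2 fun c hc =>
    hyp (hc ▸ Submodule.smul_mem _ c (Submodule.mem_span_singleton_self p))
  have hspan : Submodule.span K {p, y} ≤ LinearMap.ker (form q p) := by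
    rw [Submodule.span_le]
    rintro z (rfl | rfl)
    exacts [hpp, hy]
  -- A totally isotropic plane in the hyperplane would contain the whole hyperplane.
  have hle : LinearMap.ker (form q p) ≤ Submodule.span K {p, y} := fun z hz =>
    mem_of_form_eq_zero hq hK (finrank_span_pair hLI) (fun v hv => hker v (hspan hv))
      fun v hv => form_eq_zero_of_isotropic hq hK hker (hspan hv) hz
  have h₁ := Submodule.finrank_mono hle
  rw [hrank, finrank_span_pair hLI] at h₁
  omega

/-- The hyperplane orthogonal to an isotropic vector `p` is spanned by `p` and two orthogonal
anisotropic vectors. -/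
lemma exists_orthogonal_basis (hq : IsPrimePow q) (hK : Nat.card K = q ^ 2)
    {p : Fin 4 → K} (hp : p ≠ 0) (hpp : form q p p = 0) :
    ∃ e f, form q p e = 0 ∧ form q p f = 0 ∧ form q e f = 0 ∧ form q e e ≠ 0 ∧ form q f f ≠ 0 ∧
      ∀ w, form q p w = 0 → ∃ a b c : K, w = a • p + b • e + c • f := by
  obtain ⟨e, hpe, hee⟩ := exists_orthogonal_anisotropic hq hK hp hpp
  have hep := form_eq_zero_comm hq hK hpe
  have hLI : LinearIndependent K ![p, e] := (LinearIndependent.pair_iff' hp).2 fun c hc => by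
    apply hee
    rw [← hc, map_smul, form_smul_left, hpp, mul_zero, smul_zero]
  have hlt : ¬ perp q p e ≤ Submodule.span K {p} := by
    intro hle
    have h₁ := Submodule.finrank_mono hle
    rw [finrank_perp hq hK hLI, finrank_span_singleton hp] at h₁
    omega
  obtain ⟨f, hf, hfp⟩ := SetLike.not_le_iff_exists.1 hlt
  obtain ⟨hpf, hef⟩ := mem_perp.1 hf
  have hLI' : LinearIndependent K ![p, f] := (LinearIndependent.pair_iff' hp).2 fun c hc =>
    hfp (hc ▸ Submodule.smul_mem _ c (Submodule.mem_span_singleton_self p))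
  refine ⟨e, f, hpe, hpf, hef, hee, fun hff => ?_, fun w hw => ?_⟩
  · have hiso := isotropic_span_pair hq hK hpp hpf hff
    have he : e ∈ Submodule.span K {p, f} := by
      refine mem_of_form_eq_zero hq hK (finrank_span_pair hLI') hiso fun v hv => ?_
      obtain ⟨a, b, rfl⟩ := Submodule.mem_span_pair.1 hv
      simp [form_add_left hq hK, form_smul_left, hpe, form_eq_zero_comm hq hK hef]
    exact hee (form_eq_zero_of_isotropic hq hK hiso he he)
  · have hw' : w - (form q e w / form q e e) • e ∈ perp q p e := by
      refine mem_perp.2 ⟨by simp [hw, hpe], ?_⟩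
      rw [map_sub, map_smul, smul_eq_mul, div_mul_cancel₀ _ hee, sub_self]
    rw [← span_pair_eq_perp hq hK hLI hLI' ⟨hpp, hep⟩ hf] at hw'
    obtain ⟨a, c, hac⟩ := Submodule.mem_span_pair.1 hw'
    refine ⟨a, form q e w / form q e e, c, ?_⟩
    rw [add_right_comm, hac, sub_add_cancel]

/-- If `e, f` are as in `exists_orthogonal_basis`, the lines through `⟨p⟩` are the planes
`⟨p, z e + f⟩` with `z e + f` isotropic. -/
lemma ncard_lines (hq : IsPrimePow q) (hK : Nat.card K = q ^ 2) (x : Point q K) :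
    {l | Inc x l}.ncard = q + 1 := by
  have hp : x.1.rep ≠ 0 := x.1.rep_nonzero
  have hpp := form_rep_self x
  simp only [inc_iff]
  generalize x.1.rep = p at hp hpp
  obtain ⟨e, f, hpe, hpf, hef, hee, hff, hspan⟩ := exists_orthogonal_basis hq hK hp hpp
  have hep := form_eq_zero_comm hq hK hpe
  have hfp := form_eq_zero_comm hq hK hpf
  have hfe := form_eq_zero_comm hq hK hef
  have hnorm (b c : K) : form q (b • e + c • f) (b • e + c • f) =
      b ^ (q + 1) * form q e e + c ^ (q + 1) * form q f f := by
    simp only [form_add_left hq hK, form_smul_left, map_add, map_smul, hef, hfe, smul_eq_mul]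
    ring
  have hc0 : -(form q f f / form q e e) ≠ 0 := neg_ne_zero.2 (div_ne_zero hff hee)
  have hcq : (-(form q f f / form q e e)) ^ q = -(form q f f / form q e e) := by
    rw [neg_pow_q hq hK, div_pow, form_swap hq hK, form_swap hq hK]
  have hiso (z : K) (hz : z ^ (q + 1) = -(form q f f / form q e e)) :
      form q (z • e + f) (z • e + f) = 0 := by
    have := hnorm z 1
    rw [one_smul] at this
    rw [this, hz, one_pow]
    field_simp
    ring
  have hLI (z : K) : LinearIndependent K ![p, z • e + f] :=
    (LinearIndependent.pair_iff' hp).2 fun c hc => by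
      have := congrArg (form q f) hc
      simp only [map_smul, map_add, hfp, hfe, smul_zero, zero_add] at this
      exact hff this.symm
  refine Eq.trans (Eq.symm ?_) (ncard_pow_eq hq hK hc0 hcq)
  refine Set.ncard_congr (fun z hz => ⟨Submodule.span K {p, z • e + f},
    finrank_span_pair (hLI z), isotropic_span_pair hq hK hpp (by simp [hpe, hpf]) (hiso z hz)⟩)
    ?_ ?_ ?_
  · intro z hz
    exact Submodule.subset_span (Or.inl rfl)
  · intro z z' hz hz' heq
    have hmem : z • e + f ∈ Submodule.span K {p, z' • e + f} := by
      have heq' : Submodule.span K {p, z • e + f} = Submodule.span K {p, z' • e + f} :=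
        congrArg Subtype.val heq
      rw [← heq']
      exact Submodule.subset_span (Or.inr rfl)
    obtain ⟨a, b, hab⟩ := Submodule.mem_span_pair.1 hmem
    have h₁ := congrArg (form q f) hab
    have h₂ := congrArg (form q e) hab
    simp only [map_add, map_smul, hfp, hfe, hep, hef, smul_eq_mul, mul_zero, zero_add,
      add_zero] at h₁ h₂
    have hb : b = 1 := mul_right_cancel₀ hff (h₁.trans (one_mul _).symm)
    rw [hb, one_mul] at h₂
    exact (mul_right_cancel₀ hee h₂).symm
  · intro l hl
    have hl : p ∈ l.1 := hl
    have hlt : ¬ l.1 ≤ Submodule.span K {p} := by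
      intro hle
      have h₁ := Submodule.finrank_mono hle
      rw [l.2.1, finrank_span_singleton hp] at h₁
      omega
    obtain ⟨w, hw, hwp⟩ := SetLike.not_le_iff_exists.1 hlt
    obtain ⟨a, b, c, rfl⟩ := hspan w (form_eq_zero_of_isotropic hq hK l.2.2 hl hw)
    have hw' : b • e + c • f ∈ l.1 := by
      have := l.1.sub_mem hw (l.1.smul_mem a hl)
      rwa [add_assoc, add_sub_cancel_left] at this
    have h0 := form_eq_zero_of_isotropic hq hK l.2.2 hw' hw'
    rw [hnorm] at h0
    have hc : c ≠ 0 := by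
      rintro rfl
      rw [zero_pow (Nat.succ_ne_zero q), zero_mul, add_zero] at h0
      have hb : b = 0 := by
        simpa [hee] using h0
      subst hb
      apply hwp
      rw [zero_smul, zero_smul, add_zero, add_zero]
      exact Submodule.smul_mem _ a (Submodule.mem_span_singleton_self p)
    have hmem : (b / c) • e + f ∈ l.1 := by
      have := l.1.smul_mem c⁻¹ hw'
      rwa [smul_add, smul_smul, smul_smul, inv_mul_cancel₀ hc, one_smul, inv_mul_eq_div] at this
    refine ⟨b / c, ?_, Subtype.ext (span_pair_eq_of_finrank l.2.1 (hLI _) hl hmem)⟩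
    change (b / c) ^ (q + 1) = _
    rw [div_pow, ← neg_div, div_eq_div_iff (pow_ne_zero _ hc) hee]
    linear_combination h0

lemma nonempty_point (hq : IsPrimePow q) (hK : Nat.card K = q ^ 2) : Nonempty (Point q K) := by
  have hone : (-1 : K) ^ q = -1 := by rw [neg_pow_q hq hK, one_pow]
  have hne : {z : K | z ^ (q + 1) = -1}.Nonempty := by
    apply Set.nonempty_of_ncard_ne_zero
    rw [ncard_pow_eq hq hK (neg_ne_zero.2 one_ne_zero) hone]
    omega
  obtain ⟨z, hz⟩ := hne
  have hz : z ^ (q + 1) = -1 := hz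
  obtain ⟨x, -⟩ := exists_point (q := q) (v := ![1, z, 0, 0])
    (fun h => one_ne_zero (congrFun h 0)) (by simp [form_self, Fin.sum_univ_four, hz])
  exact ⟨x⟩

/-- The neighbour of `x` on `l` is the intersection of the plane `l` with the hyperplane
orthogonal to `x`, which does not contain `l`. -/
lemma existsUnique_line (hq : IsPrimePow q) (hK : Nat.card K = q ^ 2) (x : Point q K)
    (l : Line q K) (hxl : ¬ Inc x l) :
    ∃! m : Line q K, Inc x m ∧ ∃ y, Inc y m ∧ Inc y l := by
  have hne : LinearMap.ker (form q x.1.rep) ⊓ l.1 ≠ ⊥ := by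
    intro hbot
    have h₁ := Submodule.finrank_sup_add_finrank_inf_eq (LinearMap.ker (form q x.1.rep)) l.1
    have h₂ := Submodule.finrank_le (LinearMap.ker (form q x.1.rep) ⊔ l.1)
    rw [hbot, finrank_bot, finrank_ker_form hq x.1.rep_nonzero, l.2.1] at h₁
    rw [Module.finrank_fin_fun] at h₂
    omega
  obtain ⟨v, ⟨hxv, hvl⟩, hv⟩ := (Submodule.ne_bot_iff _).1 hne
  obtain ⟨y, hy, c, hc⟩ := exists_point hv (form_eq_zero_of_isotropic hq hK l.2.2 hvl hvl)
  have hyl := (hy l).2 hvl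
  have hxy : x ≠ y := by
    rintro rfl
    exact hxl hyl
  have hform : form q x.1.rep y.1.rep = 0 := by
    rw [hc, map_smul, show form q x.1.rep v = 0 from hxv, smul_zero]
  obtain ⟨m, hxm, hym⟩ := exists_line hq hK hxy hform
  refine ⟨m, ⟨hxm, y, hym, hyl⟩, ?_⟩
  rintro m' ⟨hxm', y', hym', hyl'⟩
  by_cases hyy : y = y'
  · subst hyy
    exact line_unique hxy hxm' hym' hxm hym
  · exfalso
    apply hxl
    rw [inc_iff]
    refine mem_of_form_eq_zero hq hK l.2.1 l.2.2 fun w hw => form_eq_zero_comm hq hK ?_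
    rw [← span_rep_eq hyy hyl hyl'] at hw
    obtain ⟨a, b, rfl⟩ := Submodule.mem_span_pair.1 hw
    rw [map_add, map_smul, map_smul, hform, form_eq_zero_of_isCollinear hq hK ⟨m', hxm', hym'⟩,
      smul_zero, smul_zero, add_zero]

theorem isGQ (hq : IsPrimePow q) (hK : Nat.card K = q ^ 2) :
    IsGQ (Inc (q := q) (K := K)) (q ^ 2) q where
  s_pos := pow_pos hq.pos 2
  t_pos := hq.pos
  nonempty := nonempty_point hq hK
  line_unique _ _ hxy _ _ hxl hyl hxm hym := line_unique hxy hxl hyl hxm hym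
  points_on_line := ncard_points hq hK
  lines_through_point := ncard_lines hq hK
  projection := existsUnique_line hq hK

/-- The common neighbours of two non-collinear points `u` and `v` span the plane orthogonal to `u`
and `v`, and this plane is already spanned by any two of them. -/
theorem hasRegularPoints (hq : IsPrimePow q) (hK : Nat.card K = q ^ 2) :
    HasRegularPoints (Inc (q := q) (K := K)) := by
  intro u v a b c p huv hab hua hva hub hvb huc hvc hpa hpb
  have huv' : u ≠ v := by
    rintro rfl
    exact huv ((isGQ hq hK).isCollinear_refl u)
  by_cases hpc : p = c
  · exact hpc ▸ (isGQ hq hK).isCollinear_refl p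
  refine exists_line hq hK hpc ?_
  have e {x y : Point q K} (h : IsCollinear Inc x y) := form_eq_zero_of_isCollinear hq hK h
  have hspan := span_pair_eq_perp hq hK (linearIndependent_rep huv') (linearIndependent_rep hab)
    (mem_perp.2 ⟨e hua, e hva⟩) (mem_perp.2 ⟨e hub, e hvb⟩)
  have hc : c.1.rep ∈ perp q u.1.rep v.1.rep := mem_perp.2 ⟨e huc, e hvc⟩
  rw [← hspan] at hc
  obtain ⟨α, β, hαβ⟩ := Submodule.mem_span_pair.1 hc
  rw [← hαβ, map_add, map_smul, map_smul, e hpa, e hpb, smul_zero, smul_zero, add_zero]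

end Hermitian

/-! ### Asymptotics of the size -/

/-- The number `(q² + 1) (q³ + 1)` of points lies between `q⁵` and `4 q⁵`, and the `2 / 5`-th powers
of these are `q²` and `4 ^ (2 / 5) q² < 9 / 4 * q²`. -/
lemma rpow_two_fifths_bounds {q : ℕ} (hq : 1 ≤ q) :
    (((q ^ 2 + 1) * (q ^ 2 * q + 1) : ℕ) : ℝ) ^ ((2 : ℝ) / 5) ≤ ((5 * q ^ 2 - 2 : ℕ) : ℝ) ∧
      ((5 * q ^ 2 - 2 : ℕ) : ℝ) ≤
        5 * (((q ^ 2 + 1) * (q ^ 2 * q + 1) : ℕ) : ℝ) ^ ((2 : ℝ) / 5) := by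
  have hq' : (1 : ℝ) ≤ q := by exact_mod_cast hq
  have hq2 : (1 : ℝ) ≤ (q : ℝ) ^ 2 := one_le_pow₀ hq'
  have hq3 : (1 : ℝ) ≤ (q : ℝ) ^ 3 := one_le_pow₀ hq'
  have hsub : ((5 * q ^ 2 - 2 : ℕ) : ℝ) = 5 * (q : ℝ) ^ 2 - 2 := by
    have : 1 ≤ q ^ 2 := Nat.one_le_pow _ _ hq
    rw [Nat.cast_sub (by omega)]
    push_cast
    ring
  -- A power `r ^ 5` has the `2 / 5`-th power `r ^ 2`.
  have hroot {r : ℝ} (hr : 0 ≤ r) : (r ^ 5) ^ ((2 : ℝ) / 5) = r ^ 2 := by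
    rw [← Real.rpow_natCast, ← Real.rpow_mul hr, ← Real.rpow_natCast]
    norm_num
  have hcast : (((q ^ 2 + 1) * (q ^ 2 * q + 1) : ℕ) : ℝ) =
      ((q : ℝ) ^ 2 + 1) * ((q : ℝ) ^ 2 * q + 1) := by push_cast; ring
  rw [hsub, hcast]
  constructor
  · -- As `4 ≤ (3 / 2) ^ 5`, the number of points is at most `(3 q / 2) ^ 5`.
    have hle : ((q : ℝ) ^ 2 + 1) * ((q : ℝ) ^ 2 * q + 1) ≤ (3 / 2 * q) ^ 5 := by
      have : ((q : ℝ) ^ 2 + 1) * ((q : ℝ) ^ 2 * q + 1) ≤ (2 * (q : ℝ) ^ 2) * (2 * (q : ℝ) ^ 3) := by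
        gcongr
        · linarith
        · linarith [show (q : ℝ) ^ 2 * q = (q : ℝ) ^ 3 by ring]
      have h5 : (0 : ℝ) ≤ (q : ℝ) ^ 5 := by positivity
      calc _ ≤ _ := this
        _ = 4 * (q : ℝ) ^ 5 := by ring
        _ ≤ (3 / 2) ^ 5 * (q : ℝ) ^ 5 := by norm_num; linarith
        _ = _ := by ring
    have := Real.rpow_le_rpow (by positivity) hle (show (0 : ℝ) ≤ 2 / 5 by norm_num)
    rw [hroot (by positivity)] at this
    nlinarith
  · have hle : (q : ℝ) ^ 5 ≤ ((q : ℝ) ^ 2 + 1) * ((q : ℝ) ^ 2 * q + 1) := by nlinarith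
    have := Real.rpow_le_rpow (by positivity) hle (show (0 : ℝ) ≤ 2 / 5 by norm_num)
    rw [hroot (by positivity)] at this
    linarith

open Hermitian in
theorem mainTheorem6 :
    ∃ a b : ℝ, 0 < a ∧ 0 < b ∧
      ∀ (q : ℕ), IsPrimePow q → ∀ (K : Type*) [Field K], Nat.card K = q ^ 2 →
        IsGQ (Inc (q := q) (K := K)) (q ^ 2) q ∧
        (∃ (L₀ L₁ L₂ M₁ M₂ : Line q K) (P₁ P₂ X : Point q K) (S C : Set (Point q K)),
          -- three pairwise disjoint lines
          Disjoint L₀.points L₁.points ∧ Disjoint L₀.points L₂.points ∧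
          Disjoint L₁.points L₂.points ∧
          -- two further lines through distinct points of `L₀`, disjoint from `L₁` and `L₂`
          P₁ ≠ P₂ ∧ P₁ ∈ L₀.points ∧ P₂ ∈ L₀.points ∧
          P₁ ∈ M₁.points ∧ P₂ ∈ M₂.points ∧ M₁ ≠ L₀ ∧ M₂ ≠ L₀ ∧
          Disjoint M₁.points L₁.points ∧ Disjoint M₁.points L₂.points ∧
          Disjoint M₂.points L₁.points ∧ Disjoint M₂.points L₂.points ∧
          -- the union of the five lines
          S = L₀.points ∪ L₁.points ∪ L₂.points ∪ M₁.points ∪ M₂.points ∧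
          S.ncard = 5 * q ^ 2 + 3 ∧ (graph q K).IsIdentifyingCode S ∧
          -- delete a point of `L₁` and all its neighbours on the other four lines
          X ∈ L₁.points ∧ ¬ (graph q K).Adj X P₁ ∧ ¬ (graph q K).Adj X P₂ ∧
          C = S \ ({X} ∪ ((graph q K).neighborSet X ∩
            (L₀.points ∪ L₂.points ∪ M₁.points ∪ M₂.points))) ∧
          C.ncard = 5 * q ^ 2 - 2 ∧ (graph q K).IsIdentifyingCode C) ∧
        a * (Nat.card (Point q K) : ℝ) ^ ((2 : ℝ) / 5) ≤ ((5 * q ^ 2 - 2 : ℕ) : ℝ) ∧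
        ((5 * q ^ 2 - 2 : ℕ) : ℝ) ≤ b * (Nat.card (Point q K) : ℝ) ^ ((2 : ℝ) / 5) := by
  refine ⟨1, 5, one_pos, by norm_num, fun q hq K _ hK => ?_⟩
  have hGQ := isGQ hq hK
  have hs : 2 ≤ q ^ 2 := hq.two_le.trans (Nat.le_self_pow two_ne_zero q)
  obtain ⟨L₀, L₁, L₂, M₁, M₂, P₁, P₂, X, F⟩ := hGQ.exists_isFiveLines hs hq.two_le
  have hC := F.smallCode_isIdentifyingCode hGQ hs (hasRegularPoints hq hK)
  refine ⟨hGQ, ⟨L₀, L₁, L₂, M₁, M₂, P₁, P₂, X, _, _,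
    Set.disjoint_left.2 F.disj₀₁, Set.disjoint_left.2 F.disj₀₂, Set.disjoint_left.2 F.disj₁₂,
    F.ne, F.mem₁, F.mem₂, F.memM₁, F.memM₂, F.neM₁, F.neM₂,
    Set.disjoint_left.2 F.disjM₁₁, Set.disjoint_left.2 F.disjM₁₂,
    Set.disjoint_left.2 F.disjM₂₁, Set.disjoint_left.2 F.disjM₂₂, rfl,
    F.ncard_union hGQ, hC.mono Set.sdiff_subset, F.memX, fun h => F.farX₁ h.2,
    fun h => F.farX₂ h.2, rfl, F.ncard_smallCode hGQ, hC⟩, ?_⟩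
  rw [hGQ.card_points, one_mul]
  exact rpow_two_fifths_bounds hq.one_lt.le
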